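/- For $c>0$ let $\chi_{[0,c)}$ be the characteristic function of $[0,c)$, and for $a,b>0$ let $$\mathcal G(\chi_{[0,c)},a\mathbb Z\times\mathbb Z/b)=\{e^{-2\pi i n t/b}\chi_{[0,c)}(t-ma):\ (m,n)\in\mathbb Z\times\mathbb Z\}.$$ This system is called a Gabor frame if it is a frame for $L^2(\mathbb R)$, i.e. if there are constants $0<A\le B<\infty$ such that $A\|f\|_2^2\le\sum_{m,n\in\mathbb Z}|\langle f,e^{-2\pi i n\cdot/b}\chi_{[0,c)}(\cdot-ma)\rangle|^2\le B\|f\|_2^2$ for all $f\in L^2(\mathbb R)$. Let $a,b,c$ be positive real numbers with $a<b<c$. Set $c_0=c-\lfloor c/b\rfloor b$ and $c_1=\lfloor c/b\rfloor b-\big\lfloor \lfloor c/b\rfloor b/a\big\rfloor a$, and assume $b-a<c_0<a$. Then the following statements hold. (VIII) If $\lfloor c/b\rfloor=1$, then $\mathcal G(\chi_{[0,c)},a\mathbb Z\times\mathbb Z/b)$ is a Gabor frame. (IX) If $\lfloor c/b\rfloor\ge 2$ and $c_1>2a-b$, then $\mathcal G(\chi_{[0,c)},a\mathbb Z\times\mathbb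 Z/b)$ is a Gabor frame. (X) If $\lfloor c/b\rfloor\ge 2$ and $c_1=2a-b$, then $\mathcal G(\chi_{[0,c)},a\mathbb Z\times\mathbb Z/b)$ is a Gabor frame if and only if there are coprime integers $p$ and $q$ with $a/b=p/q$, $c_0\le b-a+b/q$ and $\lfloor c/b\rfloor+1=p$. (XI) If $\lfloor c/b\rfloor\ge 2$ and $c_1=0$, then $\mathcal G(\chi_{[0,c)},a\mathbb Z\times\mathbb Z/b)$ is a Gabor frame if and only if there are coprime integers $p$ and $q$ with $a/b=p/q$, $c_0\ge a-b/q$ and $\lfloor c/b\rfloor=p$. -/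

import Mathlib

open MeasureTheory

noncomputable section

/-- A family `φ` of vectors in a complex Hilbert space is a frame: there are constants
`0 < A` and `B < ∞` with `A ‖f‖² ≤ ∑ |⟨φ i, f⟩|² ≤ B ‖f‖²` for all `f`. -/
def IsHilbertFrame {ι H : Type*} [NormedAddCommGroup H] [InnerProductSpace ℂ H]
    (φ : ι → H) : Prop :=
  ∃ A B : ℝ, 0 < A ∧ 0 < B ∧ ∀ f : H,
    Summable (fun i => ‖inner ℂ (φ i) f‖ ^ 2) ∧
      A * ‖f‖ ^ 2 ≤ ∑' i, ‖inner ℂ (φ i) f‖ ^ 2 ∧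
      ∑' i, ‖inner ℂ (φ i) f‖ ^ 2 ≤ B * ‖f‖ ^ 2

/-- The time-frequency shift `t ↦ e^{-2π i n t / b} φ(t - m a)` of a window function `φ`. -/
def gaborShift (φ : ℝ → ℂ) (a b : ℝ) (m n : ℤ) : ℝ → ℂ :=
  fun t => Complex.exp (-2 * (Real.pi : ℂ) * Complex.I * (n : ℂ) * (t : ℂ) / (b : ℂ)) *
    φ (t - (m : ℝ) * a)

theorem memLp_gaborShift {φ : ℝ → ℂ} (hφ : MemLp φ 2 volume) (a b : ℝ) (m n : ℤ) :
    MemLp (gaborShift φ a b m n) 2 volume := by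
  have h1 : MemLp (fun t : ℝ => φ (t - (m : ℝ) * a)) 2 volume :=
    hφ.comp_measurePreserving (measurePreserving_sub_right volume ((m : ℝ) * a))
  have hc : Continuous fun t : ℝ =>
      Complex.exp (-2 * (Real.pi : ℂ) * Complex.I * (n : ℂ) * (t : ℂ) / (b : ℂ)) := by
    fun_prop
  refine h1.of_le (hc.aestronglyMeasurable.mul h1.1) (Filter.Eventually.of_forall fun t => ?_)
  have h2 : (-2 * (Real.pi : ℂ) * Complex.I * (n : ℂ) * (t : ℂ) / (b : ℂ)) =
      ((-2 * Real.pi * n * t / b : ℝ) : ℂ) * Complex.I := by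
    push_cast
    ring
  simp only [gaborShift, h2, norm_mul, Complex.norm_exp_ofReal_mul_I, one_mul, le_refl]

/-- The Gabor system `𝓖(φ, aℤ × ℤ/b)` in `L²(ℝ)`, indexed by `(m, n) ∈ ℤ × ℤ`. -/
def gaborSystem (φ : ℝ → ℂ) (hφ : MemLp φ 2 volume) (a b : ℝ) :
    ℤ × ℤ → Lp ℂ 2 (volume : Measure ℝ) :=
  fun k => (memLp_gaborShift hφ a b k.1 k.2).toLp (gaborShift φ a b k.1 k.2)

/-- The ideal window `χ_{[0,c)}`. -/
def idealWindow (c : ℝ) : ℝ → ℂ :=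
  Set.indicator (Set.Ico 0 c) (fun _ => 1)

theorem memLp_idealWindow (c : ℝ) : MemLp (idealWindow c) 2 volume :=
  memLp_indicator_const 2 measurableSet_Ico 1 (Or.inr (by simp))

/-- `𝓖(χ_{[0,c)}, aℤ × ℤ/b)` is a Gabor frame, that is, a frame for `L²(ℝ)`. -/
def IsABCFrame (a b c : ℝ) : Prop :=
  IsHilbertFrame (gaborSystem (idealWindow c) (memLp_idealWindow c) a b)

end

/-! Parseval in the modulation index turns the frame inequality into a statement about fibres `v k =
f (t + k b)`: for each `t`, row `m` sums `v` over the `k` with `t + k b ∈ [m a, m a + c)`, and a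
bound of `v` by its row sums in `ℓ²`, uniform in `t`, gives a frame (`isABCFrame_of_fibres`).

Write `c = N b + c₀` and let `m` be the row for which `k` has phase `u = t + k b - m a ∈ [0, a)`.
Rows `m` and `m + 1` start at `k` and `k + 1`; a row has `N + 1` terms if its starting phase is
below `c₀`, otherwise `N`. So their difference is `v k` on the hole `[c₀ + a - b, c₀)`, `v k - v (k
+ N + 1)` to its left and `v k - v (k + N)` to its right. To the left the phase moves by `c₁ + b -
2a`, to the right by `-(a - c₁)`. If `c₁ > 2a - b`, both steps point towards the hole and are
shorter than its length `b - a`, so control spreads from the hole to all phases.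

If `c₁ = 2a - b` the left step is zero, and if `c₁ = 0` the right part is stuck modulo `a`. The
other part is still controlled. The stuck part is recovered when each window starting there meets it
only once (`Controlled.of_window`); otherwise a periodic dipole supported there is annihilated by
all rows for an interval of `t` (`not_isABCFrame_of_null`). The distances `|i b - j a|` decide
between the two, whence the coprime `p, q`. -/

noncomputable section

/-! ### Fibre decomposition of the Gabor coefficients -/

/-- The sum of `v k` over those `k` for which `t + k b` lies in the window `[m a, m a + c)`. -/
def winSum (a b c t : ℝ) (m : ℤ) (v : ℤ → ℂ) : ℂ :=
  ∑ k ∈ Finset.Ico ⌈((m : ℝ) * a - t) / b⌉ ⌈((m : ℝ) * a - t + c) / b⌉, v k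

theorem mem_window_iff {a b c : ℝ} (hb : 0 < b) (t : ℝ) (m k : ℤ) :
    k ∈ Finset.Ico ⌈((m : ℝ) * a - t) / b⌉ ⌈((m : ℝ) * a - t + c) / b⌉ ↔
      t + k * b - m * a ∈ Set.Ico 0 c := by
  rw [Finset.mem_Ico, Int.ceil_le, Int.lt_ceil, div_le_iff₀ hb, lt_div_iff₀ hb, Set.mem_Ico]
  constructor <;> rintro ⟨h1, h2⟩ <;> constructor <;> linarith

/-- Trades the `t`-dependent range for a fixed finite set with indicator weights, which makes the
row sums accessible to measurability and integration in `t`. -/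
theorem winSum_eq_sum_idealWindow {a b c : ℝ} (hb : 0 < b) (t : ℝ) (m : ℤ) (v : ℤ → ℂ)
    (K : Finset ℤ) (hK : ∀ k : ℤ, t + k * b - m * a ∈ Set.Ico 0 c → k ∈ K) :
    winSum a b c t m v = ∑ k ∈ K, idealWindow c (t + k * b - m * a) * v k := by
  have h : ∀ k ∈ K, idealWindow c (t + k * b - m * a) * v k =
      if k ∈ Finset.Ico ⌈((m : ℝ) * a - t) / b⌉ ⌈((m : ℝ) * a - t + c) / b⌉ then v k else 0 := by
    intro k _
    simp only [mem_window_iff hb]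
    by_cases hk : t + k * b - m * a ∈ Set.Ico 0 c <;> simp only [idealWindow, hk,
      Set.indicator_of_mem, Set.indicator_of_notMem, if_true, if_false, one_mul, zero_mul,
      not_false_eq_true]
  rw [Finset.sum_congr rfl h, Finset.sum_ite_mem, winSum]
  refine Finset.sum_congr ?_ fun _ _ => rfl
  ext k
  rw [Finset.mem_inter]
  exact ⟨fun hk => ⟨hK k ((mem_window_iff hb t m k).1 hk), hk⟩, fun hk => hk.2⟩

/-- Integers correspond to the multiples of a positive real number. -/
def intEquivZMultiples (b : ℝ) (hb : 0 < b) : ℤ ≃ AddSubgroup.zmultiples b :=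
  Equiv.ofBijective (fun k => ⟨k • b, k, rfl⟩) <| by
    constructor
    · intro j k h
      exact (zsmul_left_strictMono hb).injective (Subtype.ext_iff.1 h)
    · rintro ⟨_, k, rfl⟩
      exact ⟨k, rfl⟩

theorem lintegral_eq_tsum_setLIntegral_Ioc {b : ℝ} (hb : 0 < b) (f : ℝ → ENNReal) :
    ∫⁻ x, f x = ∑' k : ℤ, ∫⁻ t in Set.Ioc 0 b, f (t + k * b) := by
  have h := isAddFundamentalDomain_Ioc hb 0
  rw [zero_add] at h
  rw [h.lintegral_eq_tsum'' f, ← (intEquivZMultiples b hb).tsum_eq]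
  refine tsum_congr fun k => lintegral_congr fun t => ?_
  congr 1
  change k • b + t = _
  rw [zsmul_eq_mul, add_comm]

theorem integral_eq_tsum_setIntegral_Ioc {b : ℝ} (hb : 0 < b) (f : ℝ → ℂ) (hf : Integrable f) :
    ∫ x, f x = ∑' k : ℤ, ∫ t in Set.Ioc 0 b, f (t + k * b) := by
  have h := isAddFundamentalDomain_Ioc hb 0
  rw [zero_add] at h
  rw [h.integral_eq_tsum'' f hf, ← (intEquivZMultiples b hb).tsum_eq]
  refine tsum_congr fun k => integral_congr_ae (Filter.Eventually.of_forall fun t => ?_)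
  change f (k • b + t) = _
  rw [zsmul_eq_mul, add_comm]

theorem enorm_sq_eq_lintegral (f : Lp ℂ 2 (volume : Measure ℝ)) :
    ‖f‖ₑ ^ 2 = ∫⁻ x, ‖f x‖ₑ ^ 2 := by
  rw [Lp.enorm_def, eLpNorm_eq_lintegral_rpow_enorm_toReal (by norm_num) (by norm_num)]
  rw [← ENNReal.rpow_natCast, ← ENNReal.rpow_mul]
  simp

theorem enorm_sq_eq_lintegral_Ioc {b : ℝ} (hb : 0 < b) (f : Lp ℂ 2 (volume : Measure ℝ)) :
    ‖f‖ₑ ^ 2 = ∫⁻ t in Set.Ioc 0 b, ∑' k : ℤ, ‖f (t + k * b)‖ₑ ^ 2 := by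
  rw [enorm_sq_eq_lintegral, lintegral_eq_tsum_setLIntegral_Ioc hb, lintegral_tsum]
  intro k
  have hf : Measurable f := (Lp.stronglyMeasurable f).measurable
  exact ((hf.comp (measurable_id.add_const _)).enorm.pow_const 2).aemeasurable

/-- Parseval's identity on a period, for extended nonnegative sums. -/
theorem tsum_enorm_sq_fourierCoeffOn {b : ℝ} (hb : 0 < b) {F : ℝ → ℂ}
    (hF : MemLp F 2 (volume.restrict (Set.Ioc 0 b))) :
    ∑' n : ℤ, ‖(b : ℂ) * fourierCoeffOn hb F n‖ₑ ^ 2 =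
      ENNReal.ofReal b * ∫⁻ t in Set.Ioc 0 b, ‖F t‖ₑ ^ 2 := by
  have h := (hasSum_sq_fourierCoeffOn hb hF).mul_left (b ^ 2)
  have h1 : ∀ n : ℤ, ‖(b : ℂ) * fourierCoeffOn hb F n‖ₑ ^ 2 =
      ENNReal.ofReal (b ^ 2 * ‖fourierCoeffOn hb F n‖ ^ 2) := by
    intro n
    rw [← ofReal_norm, ← ENNReal.ofReal_pow (norm_nonneg _), norm_mul, mul_pow]
    simp
  simp_rw [h1]
  rw [← ENNReal.ofReal_tsum_of_nonneg (fun n => by positivity) h.summable, h.tsum_eq,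
    intervalIntegral.integral_of_le hb.le, smul_eq_mul, sub_zero, ← mul_assoc]
  have h2 : b ^ 2 * b⁻¹ = b := by field_simp
  rw [h2, ENNReal.ofReal_mul hb.le, ofReal_integral_eq_lintegral_ofReal]
  · congr 1
    refine lintegral_congr fun t => ?_
    rw [ENNReal.ofReal_pow (norm_nonneg _), ofReal_norm]
  · exact (memLp_two_iff_integrable_sq_norm hF.1).1 hF
  · exact Filter.Eventually.of_forall fun t => by positivity

theorem norm_idealWindow_le (c x : ℝ) : ‖idealWindow c x‖ ≤ 1 := by
  unfold idealWindow
  by_cases h : x ∈ Set.Ico 0 c <;> simp [h]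

theorem measurable_idealWindow (c : ℝ) : Measurable (idealWindow c) :=
  measurable_const.indicator measurableSet_Ico

/-- A finite set of indices that contains every `k` with `(k b, k b + b]` meeting
the window `[m a, m a + c)`. -/
def windowIndices (a b c : ℝ) (m : ℤ) : Finset ℤ :=
  Finset.Ico ⌈((m : ℝ) * a - b) / b⌉ ⌈((m : ℝ) * a + c) / b⌉

theorem mem_windowIndices {a b c : ℝ} (hb : 0 < b) {t : ℝ} (ht : t ∈ Set.Ioc 0 b) (m k : ℤ)
    (h : t + k * b - m * a ∈ Set.Ico 0 c) : k ∈ windowIndices a b c m := by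
  rw [windowIndices, Finset.mem_Ico, Int.ceil_le, Int.lt_ceil, div_le_iff₀ hb, lt_div_iff₀ hb]
  obtain ⟨h1, h2⟩ := h
  obtain ⟨h3, h4⟩ := ht
  constructor <;> linarith

theorem winSum_eq_sum_windowIndices {a b c : ℝ} (hb : 0 < b) {t : ℝ} (ht : t ∈ Set.Ioc 0 b)
    (m : ℤ) (f : ℝ → ℂ) :
    winSum a b c t m (fun k => f (t + k * b)) =
      ∑ k ∈ windowIndices a b c m,
        idealWindow c (t + k * b - m * a) * f (t + k * b) :=
  winSum_eq_sum_idealWindow hb t m _ _ fun k h => mem_windowIndices hb ht m k h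

theorem memLp_window_mul (c d : ℝ) {f : ℝ → ℂ} (hf : MemLp f 2 volume) :
    MemLp (fun x => idealWindow c (x - d) * f x) 2 volume := by
  refine hf.of_le ((((measurable_idealWindow c).comp
    (measurable_id.sub_const d)).aestronglyMeasurable).mul hf.1)
    (Filter.Eventually.of_forall fun x => ?_)
  rw [norm_mul]
  exact mul_le_of_le_one_left (norm_nonneg _) (norm_idealWindow_le c _)

theorem memLp_winSum {a b c : ℝ} (hb : 0 < b) (m : ℤ) {f : ℝ → ℂ} (hf : MemLp f 2 volume) :
    MemLp (fun t => winSum a b c t m (fun k => f (t + k * b))) 2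
      (volume.restrict (Set.Ioc 0 b)) := by
  have h : MemLp (fun t => ∑ k ∈ windowIndices a b c m,
      idealWindow c (t + k * b - m * a) * f (t + k * b)) 2 (volume.restrict (Set.Ioc 0 b)) := by
    refine memLp_finsetSum _ fun k _ => MemLp.restrict _ ?_
    exact (memLp_window_mul c (m * a) hf).comp_measurePreserving
      (measurePreserving_add_right volume ((k : ℝ) * b))
  refine h.ae_eq ?_
  filter_upwards [ae_restrict_mem measurableSet_Ioc] with t ht
  exact (winSum_eq_sum_windowIndices hb ht m f).symm

theorem fourier_add_int_mul (b : ℝ) (n k : ℤ) (t : ℝ) :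
    fourier n ((t + k * b : ℝ) : AddCircle (b - 0)) = fourier n (t : AddCircle (b - 0)) := by
  congr 1
  rw [← sub_eq_zero, ← AddCircle.coe_sub, add_sub_cancel_left, AddCircle.coe_eq_zero_iff]
  exact ⟨k, by simp⟩

/-- The exponential has period `b`, so it factors out when the integral is folded onto one period.
Conjugation in the first slot of the inner product accounts for the index `-n`. -/
theorem inner_gaborSystem {a b c : ℝ} (hb : 0 < b) (m n : ℤ)
    (f : Lp ℂ 2 (volume : Measure ℝ)) :
    inner ℂ (gaborSystem (idealWindow c) (memLp_idealWindow c) a b (m, n)) f =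
      (b : ℂ) * fourierCoeffOn hb (fun t => winSum a b c t m (fun k => f (t + k * b))) (-n) := by
  have hfL : MemLp f 2 volume := Lp.memLp f
  set g : ℝ → ℂ := fun x => fourier n (x : AddCircle (b - 0)) *
    (idealWindow c (x - m * a) * f x) with hg
  have hW : MemLp (fun x => idealWindow c (x - m * a)) 2 volume :=
    (memLp_idealWindow c).comp_measurePreserving (measurePreserving_sub_right volume _)
  have hint : Integrable (fun x => idealWindow c (x - m * a) * f x) := by
    simpa using! hW.integrable_mul hfL
  have hcont : Continuous fun x : ℝ => fourier n (x : AddCircle (b - 0)) :=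
    (fourier n).continuous.comp (AddCircle.continuous_mk' _)
  have hnorm : ∀ x : AddCircle (b - 0), ‖fourier n x‖ = 1 := fun x => by
    rw [fourier_apply, Circle.norm_coe]
  have hgi : Integrable g := by
    refine hint.mono (hcont.aestronglyMeasurable.mul hint.1)
      (Filter.Eventually.of_forall fun x => ?_)
    rw [hg]
    simp only [norm_mul, hnorm, one_mul, le_refl]
  have h1 : inner ℂ (gaborSystem (idealWindow c) (memLp_idealWindow c) a b (m, n)) f =
      ∫ x, g x := by
    rw [L2.inner_def]
    refine integral_congr_ae ?_
    filter_upwards [(memLp_gaborShift (memLp_idealWindow c) a b m n).coeFn_toLp] with x hx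
    have hx' : (gaborSystem (idealWindow c) (memLp_idealWindow c) a b (m, n) : ℝ → ℂ) x =
      gaborShift (idealWindow c) a b m n x := hx
    rw [hx', RCLike.inner_apply, hg]
    simp only [gaborShift, map_mul, fourier_coe_apply, ← Complex.exp_conj]
    have hc : (starRingEnd ℂ) (idealWindow c (x - m * a)) = idealWindow c (x - m * a) := by
      unfold idealWindow
      by_cases h : x - m * a ∈ Set.Ico 0 c <;> simp [h]
    rw [hc]
    have he : (starRingEnd ℂ) (-2 * (Real.pi : ℂ) * Complex.I * n * x / b) =
        2 * Real.pi * Complex.I * n * x / ((b - 0 : ℝ) : ℂ) := by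
      simp [Complex.conj_ofReal, map_ofNat]
    rw [he]
    ring
  rw [h1, integral_eq_tsum_setIntegral_Ioc hb g hgi, fourierCoeffOn_eq_integral, neg_neg,
    intervalIntegral.integral_of_le hb.le, tsum_eq_sum (s := windowIndices a b c m),
    ← integral_finsetSum]
  · rw [sub_zero, Complex.real_smul, ← mul_assoc]
    have hb' : (b : ℂ) * ((1 / b : ℝ) : ℂ) = 1 := by
      rw [← Complex.ofReal_mul, mul_one_div_cancel hb.ne', Complex.ofReal_one]
    rw [hb', one_mul]
    refine setIntegral_congr_fun measurableSet_Ioc fun t ht => ?_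
    simp only [hg, fourier_add_int_mul]
    rw [← Finset.mul_sum, winSum_eq_sum_windowIndices hb ht m f, smul_eq_mul]
    simp
  · intro k _
    exact (hgi.comp_add_right (k * b)).integrableOn
  · intro k hk
    rw [← integral_zero ℝ ℂ (μ := volume.restrict (Set.Ioc 0 b))]
    refine setIntegral_congr_fun measurableSet_Ioc fun t ht => ?_
    have : t + k * b - m * a ∉ Set.Ico 0 c := fun h => hk (mem_windowIndices hb ht m k h)
    simp [hg, idealWindow, this]

/-- The energy of the Gabor coefficients, fibre by fibre. -/
theorem tsum_enorm_sq_inner_gaborSystem {a b c : ℝ} (hb : 0 < b)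
    (f : Lp ℂ 2 (volume : Measure ℝ)) :
    ∑' i, ‖inner ℂ (gaborSystem (idealWindow c) (memLp_idealWindow c) a b i) f‖ₑ ^ 2 =
      ENNReal.ofReal b * ∫⁻ t in Set.Ioc 0 b,
        ∑' m : ℤ, ‖winSum a b c t m (fun k => f (t + k * b))‖ₑ ^ 2 := by
  rw [ENNReal.tsum_prod', lintegral_tsum, ← ENNReal.tsum_mul_left]
  · refine tsum_congr fun m => ?_
    rw [← tsum_enorm_sq_fourierCoeffOn hb (memLp_winSum hb m (Lp.memLp f)),
      ← (Equiv.neg ℤ).tsum_eq]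
    refine tsum_congr fun n => ?_
    rw [inner_gaborSystem hb, Equiv.neg_apply]
    rw [neg_neg]
  · intro m
    exact (memLp_winSum hb m (Lp.memLp f)).1.enorm.pow_const 2
end

/-! ### Uniform fibre bounds and their passage to the frame inequality -/

noncomputable section

theorem ENNReal.sq_sum_le_card_mul_sum_sq {ι : Type*} (s : Finset ι) (f : ι → ENNReal) :
    (∑ i ∈ s, f i) ^ 2 ≤ s.card * ∑ i ∈ s, f i ^ 2 := by
  have h := ENNReal.rpow_sum_le_const_mul_sum_rpow s f (p := 2) (by norm_num)
  norm_num at h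
  exact h

theorem card_window_le {a b c : ℝ} (t : ℝ) (m : ℤ) :
    (Finset.Ico ⌈((m : ℝ) * a - t) / b⌉ ⌈((m : ℝ) * a - t + c) / b⌉).card ≤ ⌈c / b⌉.toNat := by
  rw [Int.card_Ico]
  refine Int.toNat_le_toNat ?_
  have h1 := Int.le_ceil (((m : ℝ) * a - t) / b)
  have h2 := Int.ceil_lt_add_one (((m : ℝ) * a - t + c) / b)
  have h3 := Int.le_ceil (c / b)
  rw [add_div] at h2 ⊢
  have h4 : ((⌈((m : ℝ) * a - t) / b + c / b⌉ - ⌈((m : ℝ) * a - t) / b⌉ : ℤ) : ℝ) <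
      (⌈c / b⌉ + 1 : ℤ) := by
    push_cast
    linarith
  have := Int.cast_lt.1 h4
  omega

theorem enorm_winSum_le (a b c t : ℝ) (m : ℤ) (v : ℤ → ℂ) :
    ‖winSum a b c t m v‖ₑ ≤
      ∑ k ∈ Finset.Ico ⌈((m : ℝ) * a - t) / b⌉ ⌈((m : ℝ) * a - t + c) / b⌉, ‖v k‖ₑ :=
  enorm_sum_le _ _

/-- The rows of a fibre are uniformly bounded on `ℓ²`. -/
theorem exists_tsum_enorm_sq_winSum_le {a b : ℝ} (ha : 0 < a) (hb : 0 < b) (c : ℝ) :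
    ∃ B : ℕ, ∀ (t : ℝ) (v : ℤ → ℂ),
      ∑' m : ℤ, ‖winSum a b c t m v‖ₑ ^ 2 ≤ B * ∑' k : ℤ, ‖v k‖ₑ ^ 2 := by
  set D := ⌈c / b⌉.toNat
  set D' := ⌈c / a⌉.toNat
  refine ⟨D * D', fun t v => ?_⟩
  set W : ℤ → Finset ℤ := fun m =>
    Finset.Ico ⌈((m : ℝ) * a - t) / b⌉ ⌈((m : ℝ) * a - t + c) / b⌉ with hW
  have h1 : ∀ m : ℤ, ‖winSum a b c t m v‖ₑ ^ 2 ≤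
      D * ∑' k : ℤ, (W m : Set ℤ).indicator (fun k => ‖v k‖ₑ ^ 2) k := by
    intro m
    rw [← sum_eq_tsum_indicator]
    refine (pow_le_pow_left₀ (zero_le) (enorm_winSum_le a b c t m v) 2).trans
      ((ENNReal.sq_sum_le_card_mul_sum_sq _ _).trans ?_)
    gcongr
    exact card_window_le t m
  refine (ENNReal.tsum_le_tsum h1).trans ?_
  rw [ENNReal.tsum_mul_left, ENNReal.tsum_comm, Nat.cast_mul, mul_assoc]
  refine mul_le_mul_right ?_ _
  rw [← ENNReal.tsum_mul_left]
  refine ENNReal.tsum_le_tsum fun k => ?_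
  -- The second half of a Schur-type count: `V` holds the rows whose window contains `t + k b`, at
  -- most `⌈c / a⌉` of them.
  set V : Finset ℤ := Finset.Ioc ⌊(t + k * b - c) / a⌋ ⌊(t + k * b) / a⌋ with hV
  have hVcard : V.card ≤ D' := by
    rw [hV, Int.card_Ioc]
    refine Int.toNat_le_toNat ?_
    have h1 := Int.floor_le ((t + k * b) / a)
    have h2 := Int.lt_floor_add_one ((t + k * b - c) / a)
    have h3 := Int.le_ceil (c / a)
    rw [sub_div] at h2 ⊢
    have h4 : ((⌊(t + k * b) / a⌋ - ⌊(t + k * b) / a - c / a⌋ : ℤ) : ℝ) <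
        (⌈c / a⌉ + 1 : ℤ) := by
      push_cast
      linarith
    have := Int.cast_lt.1 h4
    omega
  rw [tsum_eq_sum (s := V)]
  · refine (Finset.sum_le_card_nsmul V _ (‖v k‖ₑ ^ 2) fun m _ =>
      Set.indicator_le_self _ (fun k => ‖v k‖ₑ ^ 2) k).trans ?_
    rw [nsmul_eq_mul]
    gcongr
  · intro m hm
    refine Set.indicator_of_notMem (fun hk => hm ?_) _
    obtain ⟨h1, h2⟩ := (mem_window_iff hb t m k).1 hk
    rw [hV, Finset.mem_Ioc, Int.floor_lt, Int.le_floor, div_lt_iff₀ ha, le_div_iff₀ ha]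
    constructor <;> linarith

/-- A pointwise bound by nearby terms, along an injective reindexing, is an `ℓ²` bound. -/
theorem tsum_enorm_sq_le_of_local {v y : ℤ → ℂ} {μ : ℤ → ℤ} (hμ : Function.Injective μ)
    (C : ℕ) (J : Finset ℤ) (h : ∀ k, ‖v k‖ₑ ≤ C * ∑ j ∈ J, ‖y (μ k + j)‖ₑ) :
    ∑' k, ‖v k‖ₑ ^ 2 ≤ (C ^ 2 * J.card ^ 2 : ℕ) * ∑' m, ‖y m‖ₑ ^ 2 := by
  have h1 : ∀ k, ‖v k‖ₑ ^ 2 ≤ (C ^ 2 * J.card : ℕ) * ∑ j ∈ J, ‖y (μ k + j)‖ₑ ^ 2 := by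
    intro k
    refine (pow_le_pow_left₀ (zero_le) (h k) 2).trans ?_
    rw [mul_pow]
    push_cast
    rw [mul_assoc]
    gcongr
    exact ENNReal.sq_sum_le_card_mul_sum_sq _ _
  refine (ENNReal.tsum_le_tsum h1).trans ?_
  rw [ENNReal.tsum_mul_left, Summable.tsum_finsetSum (fun _ _ => ENNReal.summable)]
  have h2 : ∀ j ∈ J, ∑' k, ‖y (μ k + j)‖ₑ ^ 2 ≤ ∑' m, ‖y m‖ₑ ^ 2 := fun j _ =>
    ENNReal.tsum_comp_le_tsum_of_injective
      (f := fun k => μ k + j) (fun k l hkl => hμ (add_right_cancel hkl)) (fun m => ‖y m‖ₑ ^ 2)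
  refine (mul_le_mul_right (Finset.sum_le_card_nsmul _ _ _ h2) _).trans (le_of_eq ?_)
  rw [nsmul_eq_mul]
  push_cast
  ring

/-- In extended nonnegative reals summability costs nothing; it is recovered from the finite upper
bound. -/
theorem isHilbertFrame_of_enorm {ι H : Type*} [NormedAddCommGroup H] [InnerProductSpace ℂ H]
    {φ : ι → H} {A B : ℝ} (hA : 0 < A) (hB : 0 < B)
    (h1 : ∀ f, ENNReal.ofReal A * ‖f‖ₑ ^ 2 ≤ ∑' i, ‖inner ℂ (φ i) f‖ₑ ^ 2)
    (h2 : ∀ f, ∑' i, ‖inner ℂ (φ i) f‖ₑ ^ 2 ≤ ENNReal.ofReal B * ‖f‖ₑ ^ 2) :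
    IsHilbertFrame φ := by
  have hsq : ∀ x : H, ‖x‖ₑ ^ 2 = ENNReal.ofReal (‖x‖ ^ 2) := fun x => by
    rw [← ofReal_norm, ENNReal.ofReal_pow (norm_nonneg _)]
  have hsq' : ∀ x : ℂ, ‖x‖ₑ ^ 2 = ENNReal.ofReal (‖x‖ ^ 2) := fun x => by
    rw [← ofReal_norm, ENNReal.ofReal_pow (norm_nonneg _)]
  refine ⟨A, B, hA, hB, fun f => ?_⟩
  have h1 := h1 f
  have h2 := h2 f
  simp only [hsq, hsq', ← ENNReal.ofReal_mul hA.le, ← ENNReal.ofReal_mul hB.le] at h1 h2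
  have hs : Summable fun i => ‖inner ℂ (φ i) f‖ ^ 2 := by
    have h3 := ENNReal.summable_toReal (ne_top_of_le_ne_top ENNReal.ofReal_ne_top h2)
    refine h3.congr fun i => ?_
    rw [ENNReal.toReal_ofReal (by positivity)]
  rw [← ENNReal.ofReal_tsum_of_nonneg (fun i => by positivity) hs] at h1 h2
  refine ⟨hs, ?_, ?_⟩
  · exact (ENNReal.ofReal_le_ofReal_iff (tsum_nonneg fun i => by positivity)).1 h1
  · exact (ENNReal.ofReal_le_ofReal_iff (by positivity)).1 h2

theorem IsHilbertFrame.exists_enorm_le {ι H : Type*} [NormedAddCommGroup H]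
    [InnerProductSpace ℂ H] {φ : ι → H} (h : IsHilbertFrame φ) :
    ∃ A : ℝ, 0 < A ∧ ∀ f, ENNReal.ofReal A * ‖f‖ₑ ^ 2 ≤ ∑' i, ‖inner ℂ (φ i) f‖ₑ ^ 2 := by
  obtain ⟨A, B, hA, hB, h⟩ := h
  refine ⟨A, hA, fun f => ?_⟩
  obtain ⟨hs, h1, -⟩ := h f
  have hsq' : ∀ x : ℂ, ‖x‖ₑ ^ 2 = ENNReal.ofReal (‖x‖ ^ 2) := fun x => by
    rw [← ofReal_norm, ENNReal.ofReal_pow (norm_nonneg _)]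
  simp only [hsq']
  rw [← ofReal_norm, ← ENNReal.ofReal_pow (norm_nonneg _), ← ENNReal.ofReal_mul hA.le,
    ← ENNReal.ofReal_tsum_of_nonneg (fun i => by positivity) hs]
  exact ENNReal.ofReal_le_ofReal h1

/-- Uniform stability of the fibres gives a frame. -/
theorem isABCFrame_of_fibres {a b c : ℝ} (ha : 0 < a) (hb : 0 < b) (C : ℕ)
    (h : ∀ (t : ℝ) (v : ℤ → ℂ),
      ∑' k : ℤ, ‖v k‖ₑ ^ 2 ≤ C * ∑' m : ℤ, ‖winSum a b c t m v‖ₑ ^ 2) :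
    IsABCFrame a b c := by
  obtain ⟨B, hB⟩ := exists_tsum_enorm_sq_winSum_le ha hb c
  have hC : (0 : ℝ) < (C : ℝ) + 1 := by positivity
  have hbB : 0 < b * (B + 1) := by positivity
  -- The factor `b` comes from Parseval; the `+ 1` keeps both constants positive if `C` or `B` is
  -- zero.
  refine isHilbertFrame_of_enorm (A := b / (C + 1)) (div_pos hb hC) hbB
    (fun f => ?_) (fun f => ?_)
  · rw [tsum_enorm_sq_inner_gaborSystem hb, enorm_sq_eq_lintegral_Ioc hb, div_eq_mul_inv,
      ENNReal.ofReal_mul hb.le, mul_assoc]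
    gcongr
    rw [ENNReal.ofReal_inv_of_pos hC, ← lintegral_const_mul']
    · refine lintegral_mono fun t => ?_
      rw [mul_comm, ← div_eq_mul_inv]
      refine ENNReal.div_le_of_le_mul' ((h t _).trans ?_)
      gcongr
      rw [← Nat.cast_succ, ENNReal.ofReal_natCast]
      exact_mod_cast Nat.le_succ C
    · exact ENNReal.inv_ne_top.2 (by simpa using hC)
  · rw [tsum_enorm_sq_inner_gaborSystem hb, enorm_sq_eq_lintegral_Ioc hb,
      ENNReal.ofReal_mul hb.le, mul_assoc]
    gcongr
    rw [← lintegral_const_mul' _ _ ENNReal.ofReal_ne_top]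
    refine lintegral_mono fun t => (hB t _).trans ?_
    gcongr
    rw [← Nat.cast_succ, ENNReal.ofReal_natCast]
    exact_mod_cast Nat.le_succ B
end

/-! ### Null vectors over an interval exclude a frame -/

noncomputable section

/-- The function whose fibre over `t` is `w` for `t ∈ (α, β)`, and `0` otherwise; here `w` is
supported in the finite set `K`. -/
def stepFunction (b α β : ℝ) (K : Finset ℤ) (w : ℤ → ℂ) (x : ℝ) : ℂ :=
  ∑ k ∈ K, (Set.Ioo α β).indicator (fun _ => w k) (x - k * b)

theorem memLp_stepFunction (b α β : ℝ) (K : Finset ℤ) (w : ℤ → ℂ) :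
    MemLp (stepFunction b α β K w) 2 volume := by
  refine memLp_finsetSum _ fun k _ => ?_
  have h : MemLp ((Set.Ioo α β).indicator fun _ => w k) 2 volume :=
    memLp_indicator_const 2 measurableSet_Ioo _ (Or.inr (by simp))
  exact h.comp_measurePreserving (measurePreserving_sub_right volume ((k : ℝ) * b))

theorem stepFunction_add {b α β : ℝ} (hα : 0 ≤ α) (hβ : β ≤ b) (K : Finset ℤ)
    (w : ℤ → ℂ) (hw : ∀ k ∉ K, w k = 0) {t : ℝ} (ht : t ∈ Set.Ioc 0 b) (j : ℤ) :
    stepFunction b α β K w (t + j * b) = (Set.Ioo α β).indicator (fun _ => w j) t := by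
  have hb : 0 < b := ht.1.trans_le ht.2
  have h : ∀ k ∈ K, k ≠ j →
      (Set.Ioo α β).indicator (fun _ => w k) (t + j * b - k * b) = 0 := by
    intro k _ hkj
    refine Set.indicator_of_notMem (fun hm => hkj ?_) _
    obtain ⟨h1, h2⟩ := hm
    obtain ⟨h3, h4⟩ := ht
    have h5 : (((j - k : ℤ) : ℝ)) * b < 1 * b := by push_cast; linarith
    have h6 : (-1 : ℝ) * b < ((j - k : ℤ) : ℝ) * b := by push_cast; linarith
    have h7 := lt_of_mul_lt_mul_right h5 hb.le
    have h8 := lt_of_mul_lt_mul_right h6 hb.le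
    have h9 : j - k < 1 := by exact_mod_cast h7
    have h10 : -1 < j - k := by exact_mod_cast h8
    omega
  unfold stepFunction
  by_cases hj : j ∈ K
  · rw [Finset.sum_eq_single_of_mem j hj h, add_sub_cancel_right]
  · rw [Finset.sum_eq_zero fun k hk => h k hk fun e => hj (e ▸ hk), hw j hj]
    simp

/-- Frees the lower bound from almost-everywhere classes, so that explicit step functions can be
inserted. -/
theorem IsABCFrame.exists_lintegral_le {a b c : ℝ} (hb : 0 < b) (h : IsABCFrame a b c) :
    ∃ A : ℝ, 0 < A ∧ ∀ f : ℝ → ℂ, MemLp f 2 volume →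
      ENNReal.ofReal A * ∫⁻ t in Set.Ioc 0 b, ∑' k : ℤ, ‖f (t + k * b)‖ₑ ^ 2 ≤
      ENNReal.ofReal b * ∫⁻ t in Set.Ioc 0 b,
        ∑' m : ℤ, ‖winSum a b c t m (fun k => f (t + k * b))‖ₑ ^ 2 := by
  obtain ⟨A, hA, h⟩ := h.exists_enorm_le
  refine ⟨A, hA, fun f hf => ?_⟩
  have h1 := h (hf.toLp f)
  rw [tsum_enorm_sq_inner_gaborSystem hb, enorm_sq_eq_lintegral_Ioc hb] at h1
  have h2 : ∀ᵐ t : ℝ, ∀ k : ℤ, hf.toLp f (t + k * b) = f (t + k * b) := by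
    rw [ae_all_iff]
    intro k
    exact (measurePreserving_add_right volume ((k : ℝ) * b)).quasiMeasurePreserving.ae_eq_comp
      hf.coeFn_toLp
  have h3 : ∀ᵐ t ∂(volume.restrict (Set.Ioc 0 b)),
      ∀ k : ℤ, hf.toLp f (t + k * b) = f (t + k * b) := ae_restrict_of_ae h2
  rw [lintegral_congr_ae (g := fun t => ∑' k : ℤ, ‖f (t + k * b)‖ₑ ^ 2)] at h1
  · refine h1.trans (le_of_eq ?_)
    congr 1
    refine lintegral_congr_ae ?_
    filter_upwards [h3] with t ht
    simp only [ht]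
  · filter_upwards [h3] with t ht
    simp only [ht]

/-- A bounded null vector of the fibres over an interval, bounded away from zero along an
arithmetic progression, prevents the Gabor system from being a frame. -/
theorem not_isABCFrame_of_null {a b c : ℝ} (ha : 0 < a) {α β : ℝ} (hα : 0 ≤ α)
    (hαβ : α < β) (hβ : β ≤ b) (v : ℤ → ℂ) (hv : ∀ k, ‖v k‖ₑ ≤ 1) {P : ℕ} (hP : 0 < P)
    (h1 : ∀ i : ℤ, v (i * P) = 1)
    (h0 : ∀ t ∈ Set.Ioo α β, ∀ m : ℤ, winSum a b c t m v = 0) : ¬ IsABCFrame a b c := by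
  intro hframe
  have hb : 0 < b := (hα.trans_lt hαβ).trans_le hβ
  obtain ⟨A, hA, hframe⟩ := hframe.exists_lintegral_le hb
  obtain ⟨B, hB⟩ := exists_tsum_enorm_sq_winSum_le ha hb c
  set D := ⌈c / b⌉.toNat
  have hsub : Set.Ioo α β ⊆ Set.Ioc 0 b := fun t ht => ⟨hα.trans_lt ht.1, ht.2.le.trans hβ⟩
  -- Truncate `v` to `n` periods. Its energy is at least `n`, while only rows across the two cuts
  -- survive, at a cost independent of `n`.
  have key : ∀ n : ℕ, ENNReal.ofReal A * n ≤ ENNReal.ofReal b * (D ^ 2 * (B * 2)) := by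
    intro n
    set K : Finset ℤ := Finset.Ico 0 (n * P) with hK
    set w : ℤ → ℂ := fun k => if k ∈ K then v k else 0 with hw
    have hwK : ∀ k ∉ K, w k = 0 := fun k hk => if_neg hk
    have hf := hframe _ (memLp_stepFunction b α β K w)
    have e1 : ∀ t ∈ Set.Ioc 0 b, (Set.Ioo α β).indicator (fun _ => (n : ENNReal)) t ≤
        ∑' k : ℤ, ‖stepFunction b α β K w (t + k * b)‖ₑ ^ 2 := by
      intro t ht
      simp only [stepFunction_add hα hβ K w hwK ht]
      by_cases htE : t ∈ Set.Ioo α β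
      · simp only [htE, Set.indicator_of_mem]
        have hinj : Function.Injective fun i : ℕ => (i : ℤ) * P := by
          intro i j hij
          have hP' : (P : ℤ) ≠ 0 := by omega
          exact_mod_cast mul_right_cancel₀ hP' hij
        refine le_trans ?_ (ENNReal.tsum_comp_le_tsum_of_injective hinj _)
        refine le_trans (le_of_eq ?_) (ENNReal.sum_le_tsum (Finset.range n))
        rw [Finset.sum_congr rfl (g := fun _ => 1)]
        · simp
        · intro i hi
          have hi' : (i : ℤ) * P ∈ K := by
            rw [hK, Finset.mem_Ico]
            have := Finset.mem_range.1 hi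
            refine ⟨by positivity, ?_⟩
            exact mul_lt_mul_of_pos_right (by exact_mod_cast this) (by exact_mod_cast hP)
          simp [hw, hi', h1]
      · simp [htE]
    have e2 : ∀ t ∈ Set.Ioc 0 b, ∑' m : ℤ,
        ‖winSum a b c t m (fun k => stepFunction b α β K w (t + k * b))‖ₑ ^ 2 ≤
        (Set.Ioo α β).indicator (fun _ => (D ^ 2 * (B * 2) : ENNReal)) t := by
      intro t ht
      simp only [stepFunction_add hα hβ K w hwK ht]
      by_cases htE : t ∈ Set.Ioo α β
      · simp only [htE, Set.indicator_of_mem]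
        -- `δ` detects the rows at the cuts: an interval avoiding `0` and `n P` lies inside the
        -- truncation range or misses it, so its sum of `w` vanishes. The upper bound applied to `δ`
        -- counts the remaining rows.
        set T : Finset ℤ := {0, (n * P : ℤ)} with hT
        set δ : ℤ → ℂ := fun k => if k ∈ T then 1 else 0 with hδ
        have hrow : ∀ m : ℤ, ‖winSum a b c t m w‖ₑ ≤ D * ‖winSum a b c t m δ‖ₑ := by
          intro m
          have hsumδ : winSum a b c t m δ = ((Finset.Ico ⌈((m : ℝ) * a - t) / b⌉
              ⌈((m : ℝ) * a - t + c) / b⌉ ∩ T).card : ℂ) := by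
            rw [winSum, hδ, Finset.sum_ite_mem]
            simp
          rcases Finset.eq_empty_or_nonempty (Finset.Ico ⌈((m : ℝ) * a - t) / b⌉
              ⌈((m : ℝ) * a - t + c) / b⌉ ∩ T) with he | he
          · have hzero : winSum a b c t m w = 0 := by
              have h0' := h0 t htE m
              have m1 : (0 : ℤ) ∉ Finset.Ico ⌈((m : ℝ) * a - t) / b⌉
                  ⌈((m : ℝ) * a - t + c) / b⌉ := fun hmem => by
                have : (0 : ℤ) ∈ Finset.Ico ⌈((m : ℝ) * a - t) / b⌉
                  ⌈((m : ℝ) * a - t + c) / b⌉ ∩ T := Finset.mem_inter.2 ⟨hmem, by simp [hT]⟩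
                rw [he] at this
                exact absurd this (Finset.notMem_empty _)
              have m2 : (n * P : ℤ) ∉ Finset.Ico ⌈((m : ℝ) * a - t) / b⌉
                  ⌈((m : ℝ) * a - t + c) / b⌉ := fun hmem => by
                have : (n * P : ℤ) ∈ Finset.Ico ⌈((m : ℝ) * a - t) / b⌉
                  ⌈((m : ℝ) * a - t + c) / b⌉ ∩ T := Finset.mem_inter.2 ⟨hmem, by simp [hT]⟩
                rw [he] at this
                exact absurd this (Finset.notMem_empty _)
              unfold winSum at h0' ⊢
              generalize ⌈((m : ℝ) * a - t) / b⌉ = s at *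
              generalize ⌈((m : ℝ) * a - t + c) / b⌉ = e at *
              rw [Finset.mem_Ico] at m1 m2
              by_cases hs : 0 < s ∧ e ≤ n * P
              · rw [← h0']
                refine Finset.sum_congr rfl fun k hk => if_pos ?_
                rw [Finset.mem_Ico] at hk
                rw [hK, Finset.mem_Ico]
                omega
              · refine Finset.sum_eq_zero fun k hk => if_neg ?_
                rw [Finset.mem_Ico] at hk
                rw [hK, Finset.mem_Ico]
                omega
            rw [hzero, enorm_zero]
            exact zero_le
          · have hge : 1 ≤ ‖winSum a b c t m δ‖ₑ := by
              rw [hsumδ, ← ofReal_norm, Complex.norm_natCast, ENNReal.ofReal_natCast]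
              exact_mod_cast he.card_pos
            have hle : ‖winSum a b c t m w‖ₑ ≤ D := by
              refine (enorm_winSum_le a b c t m w).trans
                ((Finset.sum_le_card_nsmul _ _ 1 fun k _ => ?_).trans ?_)
              · by_cases hk : k ∈ K
                · simpa [hw, hk] using hv k
                · simp [hw, hk]
              · rw [nsmul_eq_mul, mul_one]
                exact_mod_cast card_window_le t m
            exact hle.trans (le_mul_of_one_le_right zero_le hge)
        have hδs : ∑' k, ‖δ k‖ₑ ^ 2 ≤ 2 := by
          rw [tsum_eq_sum (s := T) (fun k hk => by simp [hδ, hk])]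
          refine (Finset.sum_le_card_nsmul _ _ 1 fun k hk => by simp [hδ, hk]).trans ?_
          rw [nsmul_eq_mul, mul_one]
          exact_mod_cast Finset.card_le_two
        calc ∑' m : ℤ, ‖winSum a b c t m w‖ₑ ^ 2
            ≤ ∑' m : ℤ, D ^ 2 * ‖winSum a b c t m δ‖ₑ ^ 2 := by
              refine ENNReal.tsum_le_tsum fun m => ?_
              rw [← mul_pow]
              exact pow_le_pow_left₀ zero_le (hrow m) 2
          _ ≤ D ^ 2 * (B * 2) := by
              rw [ENNReal.tsum_mul_left]
              gcongr
              refine (hB t δ).trans ?_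
              gcongr
      · simp [htE, winSum]
    have hvol : ∀ r : ENNReal, ∫⁻ t in Set.Ioc 0 b, (Set.Ioo α β).indicator (fun _ => r) t =
        r * ENNReal.ofReal (β - α) := by
      intro r
      rw [lintegral_indicator_const measurableSet_Ioo,
        Measure.restrict_apply measurableSet_Ioo, Set.inter_eq_left.2 hsub, Real.volume_Ioo]
    have h2 := (mul_le_mul_right (setLIntegral_mono' measurableSet_Ioc e1) _).trans
      (hf.trans (mul_le_mul_right (setLIntegral_mono' measurableSet_Ioc e2) _))
    rw [hvol, hvol, ← mul_assoc, ← mul_assoc] at h2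
    exact (ENNReal.mul_le_mul_iff_left (by simpa using hαβ) ENNReal.ofReal_ne_top).1 h2
  have hA' : ENNReal.ofReal A ≠ 0 := by simpa using hA
  have hfin : ENNReal.ofReal b * (D ^ 2 * (B * 2)) / ENNReal.ofReal A ≠ ⊤ := by
    refine ENNReal.div_ne_top (ENNReal.mul_ne_top ENNReal.ofReal_ne_top ?_) hA'
    exact_mod_cast ENNReal.natCast_ne_top (D ^ 2 * (B * 2))
  obtain ⟨n, hn⟩ := ENNReal.exists_nat_gt hfin
  refine absurd (key n) (not_le.2 ?_)
  rw [mul_comm (ENNReal.ofReal A)]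
  exact (ENNReal.div_lt_iff (Or.inl hA') (Or.inl ENNReal.ofReal_ne_top)).1 hn
end

/-! ### Row sums by phase, and propagation of control -/

noncomputable section

theorem sum_Ico_add_natCast (s : ℤ) (n : ℕ) (v : ℤ → ℂ) :
    ∑ k ∈ Finset.Ico s (s + n), v k = ∑ i ∈ Finset.range n, v (s + i) := by
  symm
  refine Finset.sum_nbij (fun i : ℕ => s + i) ?_ ?_ ?_ fun _ _ => rfl
  · intro i hi
    have := Finset.mem_range.1 hi
    rw [Finset.mem_Ico]
    omega
  · intro i _ j _ hij
    simp only at hij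
    omega
  · intro k hk
    rw [Finset.mem_coe, Finset.mem_Ico] at hk
    refine ⟨(k - s).toNat, ?_, ?_⟩
    · rw [Finset.mem_coe, Finset.mem_range]
      omega
    · simp only
      omega

/-- A window whose first point of the lattice comes early contains `N + 1` points. -/
theorem winSum_of_lt {a b c₀ t : ℝ} (hb : 0 < b) (hc₀ : c₀ ≤ b) (N : ℕ) {m s : ℤ}
    (h0 : 0 ≤ t + s * b - m * a) (h1 : t + s * b - m * a < c₀) (v : ℤ → ℂ) :
    winSum a b (N * b + c₀) t m v = ∑ i ∈ Finset.range (N + 1), v (s + i) := by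
  have e1 : ⌈((m : ℝ) * a - t) / b⌉ = s := by
    rw [Int.ceil_eq_iff, lt_div_iff₀ hb, div_le_iff₀ hb]
    constructor <;> linarith
  have e2 : ⌈((m : ℝ) * a - t + (N * b + c₀)) / b⌉ = s + (N + 1 : ℕ) := by
    rw [Int.ceil_eq_iff, lt_div_iff₀ hb, div_le_iff₀ hb]
    push_cast
    constructor <;> linarith
  rw [winSum, e1, e2, sum_Ico_add_natCast]

/-- A window whose first point of the lattice comes late contains `N` points. -/
theorem winSum_of_le {a b c₀ t : ℝ} (hb : 0 < b) (hc₀ : 0 ≤ c₀) (N : ℕ) {m s : ℤ}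
    (h0 : c₀ ≤ t + s * b - m * a) (h1 : t + s * b - m * a < b) (v : ℤ → ℂ) :
    winSum a b (N * b + c₀) t m v = ∑ i ∈ Finset.range N, v (s + i) := by
  have e1 : ⌈((m : ℝ) * a - t) / b⌉ = s := by
    rw [Int.ceil_eq_iff, lt_div_iff₀ hb, div_le_iff₀ hb]
    constructor <;> linarith
  have e2 : ⌈((m : ℝ) * a - t + (N * b + c₀)) / b⌉ = s + (N : ℕ) := by
    rw [Int.ceil_eq_iff, lt_div_iff₀ hb, div_le_iff₀ hb]
    push_cast
    constructor <;> linarith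
  rw [winSum, e1, e2, sum_Ico_add_natCast]

/-- The entries `v k` whose phase `t + k b - m a ∈ [0, a)` belongs to `S` are bounded by the
window sums near `m`, uniformly in `t`, `v` and `k`. -/
def Controlled (a b c : ℝ) (S : Set ℝ) : Prop :=
  ∃ C D : ℕ, ∀ (t : ℝ) (v : ℤ → ℂ) (k m : ℤ), t + k * b - m * a ∈ Set.Ico 0 a →
    t + k * b - m * a ∈ S →
    ‖v k‖ₑ ≤ C * ∑ j ∈ Finset.Icc (m - D) (m + D), ‖winSum a b c t j v‖ₑ

namespace Controlled

variable {a b c : ℝ} {S S' : Set ℝ}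

theorem mono (hS : Controlled a b c S) (h : S' ⊆ S) : Controlled a b c S' := by
  obtain ⟨C, D, hS⟩ := hS
  exact ⟨C, D, fun t v k m h1 h2 => hS t v k m h1 (h h2)⟩

theorem union (hS : Controlled a b c S) (hS' : Controlled a b c S') :
    Controlled a b c (S ∪ S') := by
  obtain ⟨C, D, hS⟩ := hS
  obtain ⟨C', D', hS'⟩ := hS'
  refine ⟨C + C', D + D', fun t v k m h1 h2 => ?_⟩
  rcases h2 with h2 | h2
  · refine (hS t v k m h1 h2).trans ?_
    gcongr
    · simp
    · omega
    · omega
  · refine (hS' t v k m h1 h2).trans ?_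
    gcongr
    · simp
    · omega
    · omega

/-- An entry bounded by controlled entries at a bounded distance and by the two neighbouring window
sums is controlled. -/
theorem step (ha : 0 < a) (hb : 0 < b) (hS : Controlled a b c S) (I : Finset ℤ)
    (h : ∀ (t : ℝ) (v : ℤ → ℂ) (k m : ℤ), t + k * b - m * a ∈ Set.Ico 0 a →
      t + k * b - m * a ∈ S' →
      (∀ i ∈ I, ∃ m' : ℤ, t + (k + i : ℤ) * b - m' * a ∈ S ∩ Set.Ico 0 a) ∧
      ‖v k‖ₑ ≤ ∑ i ∈ I, ‖v (k + i)‖ₑ + ‖winSum a b c t m v‖ₑ + ‖winSum a b c t (m + 1) v‖ₑ) :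
    Controlled a b c S' := by
  obtain ⟨C, D, hS⟩ := hS
  set M := I.sup Int.natAbs with hM
  -- Moving `k` by at most `M` moves the row index by less than `M b / a + 1`, the extra `1` because
  -- both phases lie in `[0, a)`.
  set D' := ⌈M * b / a⌉₊ + 1 with hD'
  refine ⟨I.card * C + 1 + 1, D + D', fun t v k m h1 h2 => ?_⟩
  obtain ⟨h3, h4⟩ := h t v k m h1 h2
  have hi : ∀ i ∈ I, ‖v (k + i)‖ₑ ≤
      C * ∑ j ∈ Finset.Icc (m - (D + D' : ℕ)) (m + (D + D' : ℕ)), ‖winSum a b c t j v‖ₑ := by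
    intro i hi
    obtain ⟨m', h5, h6⟩ := h3 i hi
    refine (hS t v (k + i) m' h6 h5).trans ?_
    have hiM : |(i : ℝ)| ≤ M := by
      have : i.natAbs ≤ M := Finset.le_sup (f := Int.natAbs) hi
      rw [← Int.cast_abs, Int.abs_eq_natAbs]
      exact_mod_cast this
    obtain ⟨h7, h8⟩ := abs_le.1 hiM
    have h9 : M * b ≤ ⌈M * b / a⌉₊ * a := (div_le_iff₀ ha).1 (Nat.le_ceil _)
    have h10 : i * b ≤ M * b := by gcongr
    have h11 : -(M * b) ≤ i * b := by rw [← neg_mul]; gcongr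
    obtain ⟨h12, h13⟩ := h1
    obtain ⟨h14, h15⟩ := h6
    push_cast at h14 h15
    have hlow : m - m' < (D' : ℤ) := by
      have : ((m - m' : ℤ) : ℝ) * a < ((D' : ℤ) : ℝ) * a := by
        rw [hD']; push_cast; linarith
      exact_mod_cast lt_of_mul_lt_mul_right this ha.le
    have hup : m' - m < (D' : ℤ) := by
      have : ((m' - m : ℤ) : ℝ) * a < ((D' : ℤ) : ℝ) * a := by
        rw [hD']; push_cast; linarith
      exact_mod_cast lt_of_mul_lt_mul_right this ha.le
    refine mul_le_mul_right (Finset.sum_le_sum_of_subset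
      (Finset.Icc_subset_Icc ?_ ?_)) _ <;> push_cast <;> omega
  have hm : ∀ j : ℤ, j = m ∨ j = m + 1 → ‖winSum a b c t j v‖ₑ ≤
      ∑ j ∈ Finset.Icc (m - (D + D' : ℕ)) (m + (D + D' : ℕ)), ‖winSum a b c t j v‖ₑ := by
    intro j hj
    refine Finset.single_le_sum_of_canonicallyOrdered
      (f := fun j => ‖winSum a b c t j v‖ₑ) ?_
    rw [Finset.mem_Icc]
    push_cast
    omega
  refine h4.trans ?_
  push_cast
  rw [add_mul, add_mul, one_mul, mul_assoc, ← nsmul_eq_mul]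
  push_cast at hi hm
  exact add_le_add (add_le_add (Finset.sum_le_card_nsmul _ _ _ hi) (hm m (Or.inl rfl)))
    (hm _ (Or.inr rfl))

theorem empty : Controlled a b c ∅ := ⟨0, 0, fun _ _ _ _ _ h => h.elim⟩

/-- As `δ` is at most the length of `[h, e)`, a step to the right from below `h` cannot jump over
the controlled set. Each round gains `δ`, and finitely many rounds reach `0`, so the constants stay
uniform. -/
theorem march_right {h e δ : ℝ} (he : e ≤ a) (hS : Controlled a b c (Set.Ico h e)) (hδ : 0 < δ)
    (hδe : h + δ ≤ e)
    (hstep : ∀ S, Controlled a b c S →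
      Controlled a b c {u | u ∈ Set.Ico 0 h ∧ u + δ ∈ S ∩ Set.Ico 0 a}) :
    Controlled a b c (Set.Ico 0 e) := by
  have key : ∀ n : ℕ, Controlled a b c {u | u ∈ Set.Ico 0 e ∧ h - n * δ ≤ u} := by
    intro n
    induction n with
    | zero =>
      refine hS.mono fun u hu => ?_
      obtain ⟨⟨h1, h2⟩, h3⟩ := hu
      rw [Nat.cast_zero, zero_mul, sub_zero] at h3
      exact ⟨h3, h2⟩
    | succ n ih =>
      refine (ih.union (hstep _ ih)).mono fun u hu => ?_
      obtain ⟨⟨h1, h2⟩, h3⟩ := hu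
      push_cast at h3
      by_cases huh : u < h
      · right
        refine ⟨⟨h1, huh⟩, ⟨⟨by linarith, by linarith⟩, by linarith⟩, by linarith, by linarith⟩
      · left
        have : 0 ≤ n * δ := by positivity
        exact ⟨⟨h1, h2⟩, by linarith⟩
  obtain ⟨n, hn⟩ := exists_nat_gt (h / δ)
  rw [div_lt_iff₀ hδ] at hn
  exact (key n).mono fun u hu => ⟨hu, by linarith [hu.1]⟩

theorem march_left {l h δ : ℝ} (hl : 0 ≤ l) (hS : Controlled a b c (Set.Ico l h))
    (hδ : 0 < δ) (hδl : l ≤ h - δ)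
    (hstep : ∀ S, Controlled a b c S →
      Controlled a b c {u | u ∈ Set.Ico h a ∧ u - δ ∈ S ∩ Set.Ico 0 a}) :
    Controlled a b c (Set.Ico l a) := by
  have key : ∀ n : ℕ, Controlled a b c {u | u ∈ Set.Ico l a ∧ u < h + n * δ} := by
    intro n
    induction n with
    | zero =>
      refine hS.mono fun u hu => ?_
      obtain ⟨⟨h1, h2⟩, h3⟩ := hu
      rw [Nat.cast_zero, zero_mul, add_zero] at h3
      exact ⟨h1, h3⟩
    | succ n ih =>
      refine (ih.union (hstep _ ih)).mono fun u hu => ?_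
      obtain ⟨⟨h1, h2⟩, h3⟩ := hu
      push_cast at h3
      by_cases huh : u < h
      · left
        have : 0 ≤ n * δ := by positivity
        exact ⟨⟨h1, h2⟩, by linarith⟩
      · right
        rw [not_lt] at huh
        exact ⟨⟨huh, h2⟩, ⟨⟨by linarith, by linarith⟩, by linarith⟩, by linarith, by linarith⟩
  obtain ⟨n, hn⟩ := exists_nat_gt ((a - h) / δ)
  rw [div_lt_iff₀ hδ] at hn
  exact (key n).mono fun u hu => ⟨hu, by linarith [hu.2]⟩

/-- If all phases are controlled, the Gabor system is a frame. -/
theorem isABCFrame (ha : 0 < a) (hab : a < b) (h : Controlled a b c (Set.Ico 0 a)) :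
    IsABCFrame a b c := by
  obtain ⟨C, D, h⟩ := h
  refine isABCFrame_of_fibres ha (ha.trans hab)
    (C ^ 2 * (Finset.Icc (-(D : ℤ)) D).card ^ 2) fun t v => ?_
  have hphase : ∀ k : ℤ, t + k * b - ⌊(t + k * b) / a⌋ * a ∈ Set.Ico 0 a := by
    intro k
    have h1 := (le_div_iff₀ ha).1 (Int.floor_le ((t + k * b) / a))
    have h2 := (div_lt_iff₀ ha).1 (Int.lt_floor_add_one ((t + k * b) / a))
    exact ⟨by linarith, by linarith⟩
  -- Each `k` is assigned the row where its phase is in `[0, a)`; different `k` get different rows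
  -- because `a < b`.
  refine tsum_enorm_sq_le_of_local (μ := fun k => ⌊(t + k * b) / a⌋) ?_ C _ fun k => ?_
  · have hmono : StrictMono fun k : ℤ => ⌊(t + k * b) / a⌋ := by
      refine strictMono_int_of_lt_succ fun k => ?_
      rw [← Int.add_one_le_iff, Int.le_floor, le_div_iff₀ ha]
      have := (hphase k).1
      push_cast
      linarith
    exact hmono.injective
  · refine (h t v k _ (hphase k) (hphase k)).trans (le_of_eq ?_)
    congr 1
    rw [sub_eq_add_neg, ← Finset.map_add_left_Icc, Finset.sum_map]
    rfl

end Controlled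
end

/-! ### Sufficient conditions for a frame -/

noncomputable section

namespace Controlled

variable {a b c₀ : ℝ} {N : ℕ} {S : Set ℝ}

/-- Between `c₀ + a - b` and `c₀` the difference of neighbouring window sums is a single entry. -/
theorem hole (ha : 0 < a) (hab : a < b) (h1 : b - a < c₀) (h2 : c₀ < a) :
    Controlled a b (N * b + c₀) (Set.Ico (c₀ + a - b) c₀) := by
  refine empty.step ha (ha.trans hab) ∅ fun t v k m hu hu' => ⟨by simp, ?_⟩
  obtain ⟨h3, h4⟩ := hu
  obtain ⟨h5, h6⟩ := hu'
  rw [winSum_of_lt (s := k) (ha.trans hab) (by linarith) N h3 h6,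
    winSum_of_le (s := k + 1) (ha.trans hab) (by linarith) N (by push_cast; linarith)
      (by push_cast; linarith), Finset.sum_range_succ']
  simp only [Nat.cast_add, Nat.cast_one, Nat.cast_zero, add_zero, Finset.sum_empty, zero_add]
  have h : ∀ i : ℕ, k + 1 + (i : ℤ) = k + (i + 1) := fun i => by ring
  simp only [h]
  refine le_trans (le_of_eq ?_) (enorm_sub_le (E := ℂ))
  rw [add_sub_cancel_left]

/-- Phases below `c₀ + a - b` are transported by `N + 1` lattice steps. -/
theorem move_left_part (ha : 0 < a) (hab : a < b) (h2 : c₀ < a)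
    (hS : Controlled a b (N * b + c₀) S) {δ : ℝ} (J : ℤ) (hδ : (N + 1) * b - J * a = δ) :
    Controlled a b (N * b + c₀) {u | u ∈ Set.Ico 0 (c₀ + a - b) ∧ u + δ ∈ S ∩ Set.Ico 0 a} := by
  refine hS.step ha (ha.trans hab) {(N + 1 : ℤ)} fun t v k m hu hu' => ⟨?_, ?_⟩
  · intro i hi
    rw [Finset.mem_singleton.1 hi]
    refine ⟨m + J, ?_⟩
    convert hu'.2 using 1
    push_cast
    linarith
  · obtain ⟨⟨h3, h4⟩, -⟩ := hu'
    rw [winSum_of_lt (s := k) (ha.trans hab) (by linarith) N h3 (by linarith),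
      winSum_of_lt (s := k + 1) (ha.trans hab) (by linarith) N (by push_cast; linarith)
        (by push_cast; linarith), Finset.sum_range_succ', Finset.sum_range_succ _ N]
    simp only [Nat.cast_add, Nat.cast_one, Nat.cast_zero, add_zero, Finset.sum_singleton]
    have h : ∀ i : ℕ, k + 1 + (i : ℤ) = k + (i + 1) := fun i => by ring
    simp only [h]
    rw [add_assoc]
    set s := ∑ i ∈ Finset.range N, v (k + (i + 1))
    have e : v k = v (k + (N + 1)) + ((s + v k) - (s + v (k + (N + 1)))) := by ring
    calc ‖v k‖ₑ = ‖v (k + (N + 1)) + ((s + v k) - (s + v (k + (N + 1))))‖ₑ := by rw [← e]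
      _ ≤ _ := (enorm_add_le _ _).trans (by gcongr; exact enorm_sub_le)

/-- Phases above `c₀` are transported by `N` lattice steps. -/
theorem move_right_part (ha : 0 < a) (hab : a < b) (h1 : b - a < c₀)
    (hN : 0 < N) (hS : Controlled a b (N * b + c₀) S) {δ : ℝ} (J : ℤ) (hδ : J * a - N * b = δ) :
    Controlled a b (N * b + c₀) {u | u ∈ Set.Ico c₀ a ∧ u - δ ∈ S ∩ Set.Ico 0 a} := by
  obtain ⟨N, rfl⟩ := Nat.exists_eq_add_of_lt hN
  rw [zero_add] at *
  refine hS.step ha (ha.trans hab) {(N + 1 : ℤ)} fun t v k m hu hu' => ⟨?_, ?_⟩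
  · intro i hi
    rw [Finset.mem_singleton.1 hi]
    refine ⟨m + J, ?_⟩
    convert hu'.2 using 1
    push_cast at hδ ⊢
    linarith
  · obtain ⟨⟨h3, h4⟩, -⟩ := hu'
    rw [winSum_of_le (s := k) (ha.trans hab) (by linarith) (N + 1) h3 (by linarith),
      winSum_of_le (s := k + 1) (ha.trans hab) (by linarith) (N + 1) (by push_cast; linarith)
        (by push_cast; linarith), Finset.sum_range_succ', Finset.sum_range_succ _ N]
    simp only [Nat.cast_add, Nat.cast_one, Nat.cast_zero, add_zero, Finset.sum_singleton]
    have h : ∀ i : ℕ, k + 1 + (i : ℤ) = k + (i + 1) := fun i => by ring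
    simp only [h]
    rw [add_assoc]
    set s := ∑ i ∈ Finset.range N, v (k + (i + 1))
    have e : v k = v (k + (N + 1)) + ((s + v k) - (s + v (k + (N + 1)))) := by ring
    calc ‖v k‖ₑ = ‖v (k + (N + 1)) + ((s + v k) - (s + v (k + (N + 1))))‖ₑ := by rw [← e]
      _ ≤ _ := (enorm_add_le _ _).trans (by gcongr; exact enorm_sub_le)

/-- If the window sums starting at a phase in `G` have `P` terms and only the first of them has its
phase in `G`, then control outside `G` gives control on `G`. -/
theorem of_window {G : Set ℝ} {c : ℝ} (ha : 0 < a) (hb : 0 < b) (hS : Controlled a b c S) {P : ℕ}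
    (hP : 0 < P) (hGS : ∀ u ∈ Set.Ico 0 a, u ∉ G → u ∈ S)
    (hret : ∀ i : ℕ, 0 < i → i < P → ∀ u ∈ G, ∀ u' ∈ G, ∀ j : ℤ, u' - u ≠ i * b - j * a)
    (hsum : ∀ (t : ℝ) (v : ℤ → ℂ) (k m : ℤ), t + k * b - m * a ∈ Set.Ico 0 a →
      t + k * b - m * a ∈ G → winSum a b c t m v = ∑ i ∈ Finset.range P, v (k + i)) :
    Controlled a b c G := by
  obtain ⟨P, rfl⟩ := Nat.exists_eq_add_of_lt hP
  rw [zero_add] at *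
  refine hS.step ha hb (Finset.Ico 1 (1 + (P : ℤ))) fun t v k m hu hu' => ⟨?_, ?_⟩
  · intro i hi
    rw [Finset.mem_Ico] at hi
    obtain ⟨i, rfl⟩ : ∃ n : ℕ, i = n := ⟨i.toNat, by omega⟩
    set m' := ⌊(t + (k + i : ℤ) * b) / a⌋
    have h1 := (le_div_iff₀ ha).1 (Int.floor_le ((t + (k + i : ℤ) * b) / a))
    have h2 := (div_lt_iff₀ ha).1 (Int.lt_floor_add_one ((t + (k + i : ℤ) * b) / a))
    have hp : t + (k + i : ℤ) * b - m' * a ∈ Set.Ico 0 a := ⟨by linarith, by linarith⟩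
    refine ⟨m', hGS _ hp fun hG => ?_, hp⟩
    refine hret i (by omega) (by omega) _ hu' _ hG (m' - m) ?_
    push_cast
    ring
  · have h := hsum t v k m hu hu'
    rw [Finset.sum_range_succ'] at h
    simp only [Nat.cast_add, Nat.cast_one, Nat.cast_zero, add_zero] at h
    have h3 : ∑ i ∈ Finset.range P, v (k + (i + 1)) =
        ∑ i ∈ Finset.Ico 1 (1 + (P : ℤ)), v (k + i) := by
      rw [sum_Ico_add_natCast 1 P fun i => v (k + i)]
      exact Finset.sum_congr rfl fun i _ => by rw [add_comm (i : ℤ)]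
    rw [h3] at h
    have e : v k = winSum a b c t m v - ∑ i ∈ Finset.Ico 1 (1 + (P : ℤ)), v (k + i) := by
      rw [h]; ring
    refine le_trans ?_ le_self_add
    have h4 : ‖∑ i ∈ Finset.Ico 1 (1 + (P : ℤ)), v (k + i)‖ₑ ≤
        ∑ i ∈ Finset.Ico 1 (1 + (P : ℤ)), ‖v (k + i)‖ₑ := enorm_sum_le _ _
    rw [e]
    exact enorm_sub_le.trans ((add_le_add_right h4 _).trans (add_comm _ _).le)

end Controlled

variable {a b c₀ : ℝ} {N : ℕ}

/-- Windows with one or two lattice points always give a frame. -/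
theorem isABCFrame_of_one (ha : 0 < a) (hab : a < b) (h1 : b - a < c₀) (h2 : c₀ < a) :
    IsABCFrame a b ((1 : ℕ) * b + c₀) := by
  have hb := ha.trans hab
  have hr : Controlled a b ((1 : ℕ) * b + c₀) (Set.Ico c₀ a) := by
    refine Controlled.empty.step ha hb ∅ fun t v k m hu hu' => ⟨by simp, ?_⟩
    rw [winSum_of_le (s := k) hb (by linarith) 1 hu'.1 (by linarith [hu'.2])]
    simp
  have hhr := (Controlled.hole (N := 1) ha hab h1 h2).union hr
  have hl := (hhr.mono (S' := Set.Ico (c₀ + a - b) a) fun u hu => by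
    by_cases h : u < c₀
    · exact Or.inl ⟨hu.1, h⟩
    · exact Or.inr ⟨not_lt.1 h, hu.2⟩).march_right (δ := b - a) le_rfl
      (by linarith) (by linarith) fun S hS => ?_
  · exact hl.isABCFrame ha hab
  -- Here row `m` is `v k + v (k + 1)`, and `k + 1` has phase `u + (b - a)` in row `m + 1`.
  · refine hS.step ha hb {1} fun t v k m hu hu' => ⟨?_, ?_⟩
    · intro i hi
      rw [Finset.mem_singleton.1 hi]
      refine ⟨m + 1, ?_⟩
      convert hu'.2 using 1
      push_cast
      ring
    · rw [winSum_of_lt (s := k) hb (by linarith) 1 hu.1 (by linarith [hu'.1.2]) v]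
      refine le_trans ?_ le_self_add
      simp only [Finset.sum_range_succ, Finset.sum_singleton, Finset.sum_range_zero]
      simp only [zero_add, Nat.cast_zero, Nat.cast_one, add_zero]
      have e : v k = (v k + v (k + 1)) - v (k + 1) := by ring
      rw [add_comm]
      calc ‖v k‖ₑ = ‖(v k + v (k + 1)) - v (k + 1)‖ₑ := by rw [← e]
        _ ≤ _ := enorm_sub_le

/-- With `r = N b - J a`, the steps `r + b - 2a` on the left and `a - r` on the right both lie
strictly between `0` and the hole length `b - a`. -/
theorem isABCFrame_of_lt (ha : 0 < a) (hab : a < b) (h1 : b - a < c₀) (h2 : c₀ < a) (hN : 0 < N)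
    (J : ℤ) (hJ : N * b - J * a < a) (hJ' : 2 * a - b < N * b - J * a) :
    IsABCFrame a b (N * b + c₀) := by
  have hh := Controlled.hole (N := N) ha hab h1 h2
  have hl := hh.march_right (a := a) (δ := (N + 1) * b - (J + 2 : ℤ) * a) (by linarith)
    (by push_cast; linarith) (by push_cast; linarith)
    fun S hS => hS.move_left_part ha hab h2 (J + 2) rfl
  have hr := hh.march_left (a := a) (δ := (J + 1 : ℤ) * a - N * b) (by linarith)
    (by push_cast; linarith) (by push_cast; linarith)
    fun S hS => hS.move_right_part ha hab h1 hN (J + 1) rfl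
  refine ((hl.union hr).mono fun u hu => ?_).isABCFrame ha hab
  by_cases h : u < c₀
  · exact Or.inl ⟨hu.1, h⟩
  · exact Or.inr ⟨by linarith, hu.2⟩

/-- Now `k` and `k + N + 1` have equal phase, so differences give nothing on the left. The right
part marches with step exactly `b - a`, and `hret` says that a window starting in the left part, of
length `c₀ + a - b`, does not meet it again. -/
theorem isABCFrame_of_left (ha : 0 < a) (hab : a < b) (h1 : b - a < c₀) (h2 : c₀ < a) (hN : 0 < N)
    (J : ℤ) (hJ : (N + 1) * b = J * a)
    (hret : ∀ i : ℕ, 0 < i → i < N + 1 → ∀ j : ℤ, c₀ + a - b ≤ |i * b - j * a|) :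
    IsABCFrame a b (N * b + c₀) := by
  have hb := ha.trans hab
  have hr := (Controlled.hole (N := N) ha hab h1 h2).march_left (a := a) (δ := b - a) (by linarith)
    (by linarith) (by linarith)
    fun S hS => hS.move_right_part ha hab h1 hN (J - 1) (by push_cast; linarith)
  have hl : Controlled a b (N * b + c₀) (Set.Ico 0 (c₀ + a - b)) := by
    refine hr.of_window ha hb (Nat.succ_pos N) (fun u hu hG => ?_) (fun i hi hiN u hu u' hu' j e => ?_)
      fun t v k m hu hG => ?_
    · exact ⟨not_lt.1 fun h => hG ⟨hu.1, h⟩, hu.2⟩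
    · have := hret i hi hiN j
      rw [← e] at this
      refine absurd this (not_le.2 (abs_lt.2 ?_))
      constructor <;> linarith [hu.1, hu.2, hu'.1, hu'.2]
    · exact winSum_of_lt hb (by linarith) N hu.1 (by linarith [hG.2]) v
  refine ((hl.union hr).mono fun u hu => ?_).isABCFrame ha hab
  by_cases h : u < c₀ + a - b
  · exact Or.inl ⟨hu.1, h⟩
  · exact Or.inr ⟨not_lt.1 h, hu.2⟩

/-- The mirror case: `k` and `k + N` have equal phase, and the part to recover is `[c₀, a)`, where
windows have `N` terms. -/
theorem isABCFrame_of_right (ha : 0 < a) (hab : a < b) (h1 : b - a < c₀) (h2 : c₀ < a) (hN : 0 < N)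
    (J : ℤ) (hJ : N * b = J * a)
    (hret : ∀ i : ℕ, 0 < i → i < N → ∀ j : ℤ, a - c₀ ≤ |i * b - j * a|) :
    IsABCFrame a b (N * b + c₀) := by
  have hb := ha.trans hab
  have hl := (Controlled.hole (N := N) ha hab h1 h2).march_right (a := a) (δ := b - a) h2.le
    (by linarith) (by linarith)
    fun S hS => hS.move_left_part ha hab h2 (J + 1) (by push_cast; linarith)
  have hr : Controlled a b (N * b + c₀) (Set.Ico c₀ a) := by
    refine hl.of_window ha hb hN (fun u hu hG => ?_) (fun i hi hiN u hu u' hu' j e => ?_)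
      fun t v k m hu hG => ?_
    · exact ⟨hu.1, not_le.1 fun h => hG ⟨h, hu.2⟩⟩
    · have := hret i hi hiN j
      rw [← e] at this
      refine absurd this (not_le.2 (abs_lt.2 ?_))
      constructor <;> linarith [hu.1, hu.2, hu'.1, hu'.2]
    · exact winSum_of_le hb (by linarith) N hG.1 (by linarith [hu.2]) v
  refine ((hl.union hr).mono fun u hu => ?_).isABCFrame ha hab
  by_cases h : u < c₀
  · exact Or.inl ⟨hu.1, h⟩
  · exact Or.inr ⟨not_lt.1 h, hu.2⟩
end

/-! ### Dipoles, necessity and the arithmetic of `a / b` -/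

noncomputable section

theorem sum_range_add_eq_of_periodic {v : ℤ → ℂ} {P : ℕ} (hv : ∀ k, v (k + P) = v k) (s : ℤ) :
    ∑ i ∈ Finset.range P, v (s + i) = ∑ i ∈ Finset.range P, v i := by
  have hs : ∀ s : ℤ, ∑ i ∈ Finset.range P, v (s + 1 + i) = ∑ i ∈ Finset.range P, v (s + i) := by
    intro s
    have h1 := Finset.sum_range_succ (fun i : ℕ => v (s + i)) P
    rw [Finset.sum_range_succ', hv] at h1
    simp only [Nat.cast_add, Nat.cast_one, Nat.cast_zero, add_zero] at h1
    refine (Finset.sum_congr rfl fun i _ => ?_).trans (add_right_cancel h1)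
    congr 1
    ring
  induction s using Int.induction_on with
  | zero => simp
  | succ n ih => rw [hs, ih]
  | pred n ih => rw [← ih, ← hs, sub_add_cancel]

/-- The `P`-periodic sequence that is `1` on `P ℤ`, `-1` on `l + P ℤ` and `0` elsewhere. -/
def dipole (P l : ℕ) (k : ℤ) : ℂ :=
  if (P : ℤ) ∣ k then 1 else if (P : ℤ) ∣ k - l then -1 else 0

theorem enorm_dipole_le (P l : ℕ) (k : ℤ) : ‖dipole P l k‖ₑ ≤ 1 := by
  unfold dipole
  split_ifs <;> simp

theorem dipole_add (P l : ℕ) (k : ℤ) : dipole P l (k + P) = dipole P l k := by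
  have h : k + P - l = k - l + P := by ring
  simp [dipole, h]

theorem sum_dipole {P l : ℕ} (hl : 0 < l) (hlP : l < P) (s : ℤ) :
    ∑ i ∈ Finset.range P, dipole P l (s + i) = 0 := by
  rw [sum_range_add_eq_of_periodic (dipole_add P l)]
  have h : ∀ i ∈ Finset.range P, dipole P l i =
      (if i = 0 then 1 else 0) + (if i = l then -1 else 0) := by
    intro i hi
    rw [Finset.mem_range] at hi
    unfold dipole
    have e1 : (P : ℤ) ∣ (i : ℤ) ↔ i = 0 := by
      rw [Int.natCast_dvd_natCast]
      exact ⟨fun h => Nat.eq_zero_of_dvd_of_lt h hi, fun h => h ▸ dvd_zero P⟩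
    have e2 : (P : ℤ) ∣ (i : ℤ) - l ↔ i = l := by
      refine ⟨fun h => ?_, fun h => by simp [h]⟩
      have := Int.eq_zero_of_abs_lt_dvd h (by rw [abs_lt]; constructor <;> omega)
      omega
    simp only [e1, e2]
    by_cases h0 : i = 0
    · have : i ≠ l := by omega
      simp [h0, hl.ne]
    · simp [h0]
  rw [Finset.sum_congr rfl h, Finset.sum_add_distrib, Finset.sum_ite_eq', Finset.sum_ite_eq',
    if_pos (Finset.mem_range.2 (hl.trans hlP)), if_pos (Finset.mem_range.2 hlP)]
  ring

/-- Since `P b ∈ a ℤ`, periodicity does not spread the phases: modulo `a` the support sits at `0`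
and `d` only. -/
theorem exists_of_dipole_ne_zero {a b d : ℝ} {P l : ℕ} {J j : ℤ} (hP : P * b = J * a)
    (hd : l * b - j * a = d) (hd0 : 0 ≤ d) {k : ℤ} (hk : dipole P l k ≠ 0) :
    ∃ e ∈ Set.Icc 0 d, ∃ n : ℤ, k * b = e + n * a := by
  unfold dipole at hk
  split_ifs at hk with h1 h2
  · obtain ⟨n, rfl⟩ := h1
    refine ⟨0, ⟨le_rfl, hd0⟩, n * J, ?_⟩
    push_cast
    linear_combination (n : ℝ) * hP
  · obtain ⟨n, hn⟩ := h2
    refine ⟨d, ⟨hd0, le_rfl⟩, n * J + j, ?_⟩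
    have hn' : (k : ℝ) - l = P * n := by exact_mod_cast hn
    push_cast
    linear_combination (n : ℝ) * hP + b * hn' + hd
  · exact absurd rfl hk

theorem int_mul_notMem_Ioo {a : ℝ} (ha : 0 < a) (n : ℤ) : (n : ℝ) * a ∉ Set.Ioo (-a) 0 := by
  rintro ⟨h1, h2⟩
  have h3 : (n : ℝ) < 0 := by
    by_contra h
    exact absurd (mul_nonneg (not_lt.1 h) ha.le) (not_le.2 h2)
  have h4 : (n : ℝ) ≤ -1 := by
    have : n < 0 := by exact_mod_cast h3
    have : n ≤ -1 := by omega
    exact_mod_cast this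
  nlinarith

theorem exists_first_index {b : ℝ} (hb : 0 < b) (x : ℝ) :
    ∃ s : ℤ, 0 ≤ s * b - x ∧ s * b - x < b := by
  refine ⟨⌈x / b⌉, ?_, ?_⟩
  · linarith [(div_le_iff₀ hb).1 (Int.le_ceil (x / b))]
  · have := (lt_div_iff₀ hb).1 (sub_lt_iff_lt_add.2 (Int.ceil_lt_add_one (x / b)))
    linarith

variable {a b c₀ : ℝ} {N : ℕ}

/-- For `t` in the chosen interval the dipole lives on phases in `[0, c₀ + a - b)`. Rows of `N + 1`
terms are full periods; a row of `N` terms lacks only the entry before it, whose phase modulo `a` is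
at least `c₀ + a - b`, so that entry is zero. -/
theorem not_isABCFrame_of_left (ha : 0 < a) (hab : a < b) (h1 : b - a < c₀) (h2 : c₀ < a)
    {J j : ℤ} (hJ : (N + 1) * b = J * a) {l : ℕ} (hl : 0 < l) (hlN : l < N + 1)
    (hd0 : 0 ≤ l * b - j * a) (hd : l * b - j * a < c₀ + a - b) :
    ¬ IsABCFrame a b (N * b + c₀) := by
  have hb := ha.trans hab
  refine not_isABCFrame_of_null ha (α := 0) (β := c₀ + a - b - (l * b - j * a)) le_rfl
    (by linarith) (by linarith) (dipole (N + 1) l) (enorm_dipole_le _ _) (Nat.succ_pos N)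
    (fun i => by simp [dipole]) fun t ht m => ?_
  obtain ⟨s, hs0, hs1⟩ := exists_first_index hb (m * a - t)
  by_cases hu : t + s * b - m * a < c₀
  · rw [winSum_of_lt hb (by linarith) N (by linarith) hu, sum_dipole hl hlN]
  · rw [winSum_of_le hb (by linarith) N (not_lt.1 hu) (by linarith)]
    have h := sum_dipole hl hlN (s - 1)
    rw [Finset.sum_range_succ'] at h
    simp only [Nat.cast_add, Nat.cast_one, Nat.cast_zero, add_zero] at h
    have h0 : dipole (N + 1) l (s - 1) = 0 := by
      by_contra hne
      obtain ⟨e, he, n, hn⟩ := exists_of_dipole_ne_zero (a := a) (b := b) (J := J)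
        (by push_cast; exact hJ) rfl hd0 hne
      refine int_mul_notMem_Ioo ha (m - n - 1) ?_
      push_cast at hn ⊢
      constructor <;> linarith [he.1, he.2, ht.1, ht.2]
    rw [h0, add_zero] at h
    rw [← h]
    refine Finset.sum_congr rfl fun i _ => ?_
    congr 1
    ring

/-- Here the dipole lives on phases in `[c₀, a)`. A row of `N + 1` terms is a period plus a copy of
its first entry, which has phase below `c₀` and so vanishes. -/
theorem not_isABCFrame_of_right (ha : 0 < a) (hab : a < b) (h1 : b - a < c₀) (h2 : c₀ < a)
    {J j : ℤ} (hJ : N * b = J * a) {l : ℕ} (hl : 0 < l) (hlN : l < N)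
    (hd0 : 0 ≤ l * b - j * a) (hd : l * b - j * a < a - c₀) :
    ¬ IsABCFrame a b (N * b + c₀) := by
  have hb := ha.trans hab
  refine not_isABCFrame_of_null ha (α := c₀) (β := a - (l * b - j * a)) (by linarith)
    (by linarith) (by linarith) (dipole N l) (enorm_dipole_le _ _) (hl.trans hlN)
    (fun i => by simp [dipole]) fun t ht m => ?_
  obtain ⟨s, hs0, hs1⟩ := exists_first_index hb (m * a - t)
  by_cases hu : t + s * b - m * a < c₀
  · rw [winSum_of_lt hb (by linarith) N (by linarith) hu, Finset.sum_range_succ,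
      sum_dipole hl hlN, zero_add, dipole_add]
    by_contra hne
    obtain ⟨e, he, n, hn⟩ := exists_of_dipole_ne_zero hJ rfl hd0 hne
    refine int_mul_notMem_Ioo ha (n - m) ?_
    push_cast
    constructor <;> linarith [he.1, he.2, ht.1, ht.2]
  · rw [winSum_of_le hb (by linarith) N (not_lt.1 hu) (by linarith), sum_dipole hl hlN]

/-- `i b - j a = (b / q) (i q - j p)`, and the integer factor is nonzero because `p` cannot divide
`i`. -/
theorem le_abs_of_coprime {L : ℝ} (ha : 0 < a) (hb : 0 < b) {p q : ℤ} (hpq : IsCoprime p q)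
    (hab : a / b = p / q) (hL : L ≤ b / q) {P : ℕ} (hP : (P : ℤ) = p) (i : ℕ) (hi : 0 < i)
    (hiP : i < P) (j : ℤ) : L ≤ |i * b - j * a| := by
  have hp : (0 : ℝ) < p := by
    rw [← hP]
    exact_mod_cast hi.trans hiP
  have hq : (0 : ℝ) < q := by
    have h := div_pos ha hb
    rw [hab] at h
    exact (div_pos_iff_of_pos_left hp).1 h
  rw [div_eq_div_iff hb.ne' hq.ne'] at hab
  have hne : (i * q - j * p : ℤ) ≠ 0 := by
    intro h0
    have h1 : p ∣ i * q := ⟨j, by linarith⟩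
    have h2 := hpq.dvd_of_dvd_mul_right h1
    rw [← hP, Int.natCast_dvd_natCast] at h2
    exact absurd (Nat.le_of_dvd hi h2) (by omega)
  have h1 : (1 : ℝ) ≤ |(i * q - j * p : ℝ)| := by
    exact_mod_cast Int.one_le_abs hne
  have h2 : (i * b - j * a) = b / q * (i * q - j * p) := by
    field_simp
    linear_combination -(j : ℝ) * hab
  refine hL.trans ?_
  rw [h2, abs_mul, abs_of_pos (div_pos hb hq)]
  exact le_mul_of_one_le_right (div_pos hb hq).le h1

/-- A common factor `g > 1` of `P` and `J` would give distance zero at `i = P / g`. Once they are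
coprime, some `i` realises the distance `b / J` exactly, so `q = J`. -/
theorem exists_coprime_of_le {L : ℝ} (ha : 0 < a) (hb : 0 < b) (hL : 0 < L) {P : ℕ} (hP : 2 ≤ P)
    {J : ℤ} (hJ : P * b = J * a)
    (h : ∀ i : ℕ, 0 < i → i < P → ∀ j : ℤ, 0 ≤ i * b - j * a → L ≤ i * b - j * a) :
    ∃ p q : ℤ, IsCoprime p q ∧ a / b = p / q ∧ L ≤ b / q ∧ (P : ℤ) = p := by
  have hP0 : (0 : ℝ) < P := by exact_mod_cast (by omega : 0 < P)
  have hJ0 : (0 : ℝ) < J := by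
    have : 0 < J * a := hJ ▸ mul_pos hP0 hb
    exact (pos_iff_pos_of_mul_pos this).2 ha
  have hcop : IsCoprime (P : ℤ) J := by
    rw [Int.isCoprime_iff_gcd_eq_one]
    by_contra hg
    set g := Int.gcd P J with hgdef
    have hg0 : g ≠ 0 := by
      intro h0
      rw [hgdef, Int.gcd_eq_zero_iff] at h0
      omega
    obtain ⟨x, hx⟩ : (g : ℤ) ∣ P := Int.gcd_dvd_left _ _
    obtain ⟨y, hy⟩ : (g : ℤ) ∣ J := Int.gcd_dvd_right _ _
    have hg2 : (2 : ℤ) ≤ g := by omega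
    have hx0 : 0 < x := by
      by_contra hx0
      nlinarith
    have hxP : x < P := by nlinarith
    have hgr : (g : ℝ) ≠ 0 := by exact_mod_cast hg0
    have hxb : x * b = y * a := by
      have hx' : (P : ℝ) = g * x := by exact_mod_cast hx
      have hy' : (J : ℝ) = g * y := by exact_mod_cast hy
      rw [hx', hy', mul_assoc, mul_assoc] at hJ
      exact mul_left_cancel₀ hgr hJ
    lift x to ℕ using hx0.le
    have hxb' : (x : ℝ) * b - y * a = 0 := by
      rw [sub_eq_zero]
      exact_mod_cast hxb
    have := h x (by exact_mod_cast hx0) (by exact_mod_cast hxP) y hxb'.ge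
    linarith
  refine ⟨P, J, hcop, ?_, ?_, rfl⟩
  · rw [div_eq_div_iff hb.ne' hJ0.ne', Int.cast_natCast]
    linarith
  · obtain ⟨x, y, hxy⟩ := hcop
    -- The inverse of `J` modulo `P`, reduced to the admissible range.
    set i := y % P with hi
    have hPz : (0 : ℤ) < P := by omega
    have hi0 : 0 ≤ i := Int.emod_nonneg _ hPz.ne'
    have hiP : i < P := Int.emod_lt_of_pos _ hPz
    have hdiv : P * (y / P) + i = y := Int.mul_ediv_add_emod y P
    have hij : i * J - (-(x + y / P * J)) * P = 1 := by
      linear_combination hxy + J * hdiv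
    have hine : i ≠ 0 := by
      intro h0
      rw [h0, zero_mul, zero_sub] at hij
      have : (P : ℤ) ∣ 1 := ⟨x + y / P * J, by linarith⟩
      have := Int.le_of_dvd one_pos this
      omega
    generalize -(x + y / P * J) = j at hij
    clear_value i
    lift i to ℕ using hi0
    have hij' : (i : ℝ) * J - j * P = 1 := by exact_mod_cast hij
    have e : (i : ℝ) * b - j * a = b / J := by
      rw [eq_div_iff hJ0.ne']
      linear_combination b * hij' + (j : ℝ) * hJ
    rw [← e]
    refine h i (by omega) (by omega) j ?_
    rw [e]
    positivity

theorem isABCFrame_left_iff (ha : 0 < a) (hab : a < b) (h1 : b - a < c₀) (h2 : c₀ < a) (hN : 2 ≤ N)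
    {J : ℤ} (hJ : (N + 1) * b = J * a) :
    IsABCFrame a b (N * b + c₀) ↔ ∃ p q : ℤ, IsCoprime p q ∧ a / b = (p : ℝ) / (q : ℝ) ∧
      c₀ + a - b ≤ b / q ∧ ((N + 1 : ℕ) : ℤ) = p := by
  constructor
  · intro hf
    refine exists_coprime_of_le ha (ha.trans hab) (by linarith) (by omega) (J := J)
      (by push_cast; exact hJ) fun i hi hiN j hj => ?_
    by_contra hlt
    exact not_isABCFrame_of_left ha hab h1 h2 hJ hi hiN hj (not_le.1 hlt) hf
  · rintro ⟨p, q, hpq, hq, hL, hP⟩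
    exact isABCFrame_of_left ha hab h1 h2 (by omega) J hJ
      (le_abs_of_coprime ha (ha.trans hab) hpq hq hL hP)

theorem isABCFrame_right_iff (ha : 0 < a) (hab : a < b) (h1 : b - a < c₀) (h2 : c₀ < a)
    (hN : 2 ≤ N) {J : ℤ} (hJ : N * b = J * a) :
    IsABCFrame a b (N * b + c₀) ↔ ∃ p q : ℤ, IsCoprime p q ∧ a / b = (p : ℝ) / (q : ℝ) ∧
      a - c₀ ≤ b / q ∧ (N : ℤ) = p := by
  constructor
  · intro hf
    refine exists_coprime_of_le ha (ha.trans hab) (by linarith) hN hJ fun i hi hiN j hj => ?_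
    by_contra hlt
    exact not_isABCFrame_of_right ha hab h1 h2 hJ hi hiN hj (not_le.1 hlt) hf
  · rintro ⟨p, q, hpq, hq, hL, hP⟩
    exact isABCFrame_of_right ha hab h1 h2 (by omega) J hJ
      (le_abs_of_coprime ha (ha.trans hab) hpq hq hL hP)
end

theorem mainTheorem4 (a b c c₀ c₁ : ℝ) (ha : 0 < a) (hab : a < b) (hbc : b < c)
    (hc₀ : c₀ = c - (⌊c / b⌋ : ℝ) * b) (hbac₀ : b - a < c₀) (hc₀a : c₀ < a)
    (hc₁ : c₁ = (⌊c / b⌋ : ℝ) * b - (⌊(⌊c / b⌋ : ℝ) * b / a⌋ : ℝ) * a) :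
    (⌊c / b⌋ = 1 → IsABCFrame a b c) ∧
    (2 ≤ ⌊c / b⌋ → 2 * a - b < c₁ → IsABCFrame a b c) ∧
    (2 ≤ ⌊c / b⌋ → c₁ = 2 * a - b →
      (IsABCFrame a b c ↔
        ∃ p q : ℤ, IsCoprime p q ∧ a / b = (p : ℝ) / (q : ℝ) ∧
          c₀ ≤ b - a + b / (q : ℝ) ∧ ⌊c / b⌋ + 1 = p)) ∧
    (2 ≤ ⌊c / b⌋ → c₁ = 0 →
      (IsABCFrame a b c ↔
        ∃ p q : ℤ, IsCoprime p q ∧ a / b = (p : ℝ) / (q : ℝ) ∧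
          a - b / (q : ℝ) ≤ c₀ ∧ ⌊c / b⌋ = p)) := by
  have hb := ha.trans hab
  have hfl : 0 ≤ ⌊c / b⌋ := Int.floor_nonneg.2 (div_pos (hb.trans hbc) hb).le
  generalize ⌊c / b⌋ = M at *
  lift M to ℕ using hfl
  have hc : c = M * b + c₀ := by
    rw [hc₀]
    push_cast
    ring
  rw [hc]
  simp only [Int.cast_natCast] at hc₁
  have hJ := (div_lt_iff₀ ha).1 (Int.lt_floor_add_one ((M : ℝ) * b / a))
  generalize ⌊(M : ℝ) * b / a⌋ = J at *
  refine ⟨fun hM => ?_, fun hM h => ?_, fun hM h => ?_, fun hM h => ?_⟩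
  · have hM' : M = 1 := by exact_mod_cast hM
    rw [hM']
    exact isABCFrame_of_one ha hab hbac₀ hc₀a
  · exact isABCFrame_of_lt ha hab hbac₀ hc₀a (by omega) J (by linarith) (by linarith)
  -- `c₁ = 2a - b` says `(N + 1) b = (J + 2) a`, with `J` the floor of `N b / a`.
  · rw [isABCFrame_left_iff ha hab hbac₀ hc₀a (by omega) (J := J + 2)
      (by push_cast; linarith)]
    simp only [Nat.cast_add, Nat.cast_one, sub_le_iff_le_add, ← le_sub_iff_add_le]
    refine exists_congr fun p => exists_congr fun q => and_congr_right fun _ =>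
      and_congr_right fun _ => and_congr_left fun _ => ?_
    constructor <;> intro h <;> linarith
  · rw [isABCFrame_right_iff ha hab hbac₀ hc₀a (by omega) (J := J) (by linarith)]
    refine exists_congr fun p => exists_congr fun q => and_congr_right fun _ =>
      and_congr_right fun _ => and_congr_left fun _ => ?_
    constructor <;> intro h <;> linarith
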